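/- **Setting.** $\mathrm D(\mathbb C^m)$ is the set of density matrices (positive semidefinite, trace one), $\mathrm L(\mathbb C^m)$ the set of $m\times m$ complex matrices, and $\langle A,B\rangle=\operatorname{Tr}(A^\dagger B)$. For $R\in \mathrm L(\mathcal A\otimes\mathcal B)$ let $\Theta_R:\mathrm L(\mathcal B)\to \mathrm L(\mathcal A)$, $\Theta_R(Y)=\operatorname{Tr}_{\mathcal B}(R(\mathbb 1_{\mathcal A}\otimes Y^{\top}))$, be the super-operator corresponding to $R$ under the Choi–Jamiołkowski isomorphism, with adjoint $\Theta_R^\dagger$. A *quantum game* with a finite set of players has, for each player $i$, a register $\mathcal H_i=\mathbb C^{n_i}$ with $1\le n_i<\infty$ and a Hermitian utility tensor $R_i\in \mathrm L(\bigotimes_j\mathcal H_j)$; the utility of $i$ in the joint state $\rho\in\mathrm D(\bigotimes_j\mathcal H_j)$ is $u_i(\rho)=\operatorname{Tr}(\rho R_i)$. Put $n=\max_i n_i$, and let $\Theta_i=\Theta_{R_i}$ with $\mathcal A=\mathcal H_i$, $\mathcal B=\bigotimes_{j\ne i}\mathcal H_j$. "Utilities in $[-1,1]$" means $u_i(\bigotimes_j\rho_j)\in[-1,1]$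 for every player $i$ and all $\rho_j\in \mathrm D(\mathcal H_j)$. A player runs *Matrix Multiplicative Weights Update (MMWU)* with fixed stepsize $\eta$ against gain matrices $G^1,G^2,\dots$ if $W^1=\mathbb 1$ and, for $t\ge1$, the player plays $\rho^t=W^t/\operatorname{Tr}W^t$ and updates $W^{t+1}=\exp\big(\eta\sum_{\tau=1}^tG^\tau\big)$. In a quantum game player $i$'s gain matrix is $G_i^t=\Theta_i\big((\bigotimes_{j\ne i}\rho_j^t)^{\top}\big)$. A joint state $\rho$ is an *$\epsilon$-QCCE* if $u_i(\rho)\ge u_i((\phi_i\otimes \mathrm{id}_{-i})(\rho))-\epsilon$ for all $i$ and all replacement channels $\phi_i(X)=\operatorname{Tr}(X)\rho_i'$ with $\rho_i'\in\mathrm D(\mathcal H_i)$. It is *separable* if it is a convex combination of product states. A product state $\bigotimes_i\rho_i$ is an *$\epsilon$-QNE* if $u_i(\bigotimes_j\rho_j)\ge u_i(\rho_i'\otimes\bigotimes_{j\neq i}\rho_j)-\epsilon$ for all $i$ and $\rho_i'\in\mathrm D(\mathcal H_i)$. **Statement.** Let $\epsilon>0$ and let $T\ge1$ be an integer. 1.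 *(General quantum games.)* If all utilities of a quantum game are in $[-1,1]$, $\epsilon\le2$, all players use MMWU with stepsize $\epsilon/2$, and $T\ge \frac{4\ln n}{\epsilon^2}$, then $\frac1T\sum_{t=1}^T\bigotimes_i\rho_i^t$ is a separable $\epsilon$-QCCE. 2. *(Two-player zero-sum games.)* Let $R\in \mathrm L(\mathcal A\otimes\mathcal B)$ be Hermitian, where $\mathcal A,\mathcal B\ne 0$ are the registers of Alice and Bob, of finite dimension, and $n=\max(\dim\mathcal A,\dim\mathcal B)$. Let $\Theta=\Theta_R$, $u_A(\rho,\sigma)=\langle\rho,\Theta(\sigma)\rangle$ and $u_B=-u_A$, with values in $[-1,1]$ on $\mathrm D(\mathcal A)\times\mathrm D(\mathcal B)$. If $\epsilon\le4$, both players use MMWU with stepsize $\epsilon/4$ (gain matrices $\Theta(\sigma^t)$ for Alice, $-\Theta^\dagger(\rho^t)$ for Bob), and $T\ge\frac{16\ln n}{\epsilon^2}$, then $\big(\frac1T\sum_{t=1}^T\rho^t,\frac1T\sum_{t=1}^T\sigma^t\big)$ is an $\epsilon$-QNE. 3. *(Polymatrix zero-sum games.)* Let an undirected simple graph on the set of $k$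 players be given, and for each edge and each ordering $(i,j)$ of its ends a Hermitian $R_{ij}\in \mathrm L(\mathcal H_i\otimes\mathcal H_j)$. Put $u_i(\rho)=\sum_{j:(i,j)\in E}\operatorname{Tr}(\rho_{ij}R_{ij})$, where $\rho_{ij}$ is the reduced state of $\rho$ on $\mathcal H_i\otimes\mathcal H_j$; this is the quantum game with $R_i=\sum_{j:(i,j)\in E}R_{ij}\otimes\mathbb 1_{-ij}$. Suppose $\sum_iu_i(\rho)=0$ for all joint states $\rho$ and all utilities $u_i$ are in $[-1,1]$. If $\epsilon\le2k$, all players use MMWU with stepsize $\frac{\epsilon}{2k}$, and $T\ge\frac{4k^2\ln n}{\epsilon^2}$, then the product of the time averages $\frac1T\sum_{t=1}^T\rho_i^t$ over the players $i$ is an $\epsilon$-QNE. -/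

import Mathlib

open scoped ComplexOrder Kronecker

namespace QGame

/-- The set `D(ℂⁿ)` of density matrices: positive semidefinite of trace one. -/
def IsDensity {n : Type*} [Fintype n] (ρ : Matrix n n ℂ) : Prop :=
  ρ.PosSemidef ∧ ρ.trace = 1

/-- Hilbert-Schmidt inner product `⟨A, B⟩ = Tr (A† B)`. -/
def hsInner {n : Type*} [Fintype n] (A B : Matrix n n ℂ) : ℂ :=
  (A.conjTranspose * B).trace

/-- Partial trace over the second tensor factor. -/
def traceRight {A B : Type*} [Fintype B] (X : Matrix (A × B) (A × B) ℂ) : Matrix A A ℂ :=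
  Matrix.of fun a a' => ∑ b, X (a, b) (a', b)

/-- Partial trace over the first tensor factor. -/
def traceLeft {A B : Type*} [Fintype A] (X : Matrix (A × B) (A × B) ℂ) : Matrix B B ℂ :=
  Matrix.of fun b b' => ∑ a, X (a, b) (a, b')

/-- The super-operator `Θ_R : L(ℬ) → L(𝒜)`, `Θ_R(Y) = Tr_ℬ (R (1 ⊗ Yᵀ))`, that corresponds to
`R ∈ L(𝒜 ⊗ ℬ)` under the Choi-Jamiołkowski isomorphism. -/
def choiMap {A B : Type*} [Fintype A] [DecidableEq A] [Fintype B]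
    (R : Matrix (A × B) (A × B) ℂ) (Y : Matrix B B ℂ) : Matrix A A ℂ :=
  traceRight (R * ((1 : Matrix A A ℂ) ⊗ₖ Y.transpose))

/-- The adjoint super-operator `Θ_R† : L(𝒜) → L(ℬ)` in explicit form; see `hsInner_choiMap`. -/
def choiAdjoint {A B : Type*} [Fintype A] [Fintype B] [DecidableEq B]
    (R : Matrix (A × B) (A × B) ℂ) (X : Matrix A A ℂ) : Matrix B B ℂ :=
  (traceLeft (R.conjTranspose * (X ⊗ₖ (1 : Matrix B B ℂ)))).transpose

theorem choiMap_apply {A B : Type*} [Fintype A] [DecidableEq A] [Fintype B]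
    (R : Matrix (A × B) (A × B) ℂ) (Y : Matrix B B ℂ) (a a' : A) :
    choiMap R Y a a' = ∑ b, ∑ b', R (a, b) (a', b') * Y b b' := by
  simp [choiMap, traceRight, Matrix.mul_apply, Fintype.sum_prod_type, Matrix.one_apply]

theorem choiAdjoint_apply {A B : Type*} [Fintype A] [Fintype B] [DecidableEq B]
    (R : Matrix (A × B) (A × B) ℂ) (X : Matrix A A ℂ) (b b' : B) :
    choiAdjoint R X b b' = ∑ a', ∑ a, star (R (a, b) (a', b')) * X a a' := by
  simp [choiAdjoint, traceLeft, Matrix.mul_apply, Fintype.sum_prod_type, Matrix.one_apply]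

/-- The defining property of the adjoint: `⟨X, Θ(Y)⟩ = ⟨Θ†(X), Y⟩`. -/
theorem hsInner_choiMap {A B : Type*} [Fintype A] [DecidableEq A] [Fintype B] [DecidableEq B]
    (R : Matrix (A × B) (A × B) ℂ) (X : Matrix A A ℂ) (Y : Matrix B B ℂ) :
    hsInner X (choiMap R Y) = hsInner (choiAdjoint R X) Y := by
  simp only [hsInner, Matrix.trace, Matrix.diag_apply, Matrix.mul_apply,
    Matrix.conjTranspose_apply, choiMap_apply, choiAdjoint_apply, star_sum, star_mul', star_star,
    Finset.mul_sum, Finset.sum_mul]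
  rw [Finset.sum_congr rfl fun a' _ => Finset.sum_congr rfl fun a _ => Finset.sum_comm,
    Finset.sum_congr rfl fun a' _ => Finset.sum_comm, Finset.sum_comm]
  refine Finset.sum_congr rfl fun b' _ => ?_
  rw [Finset.sum_congr rfl fun a' _ => Finset.sum_comm, Finset.sum_comm]
  refine Finset.sum_congr rfl fun b _ => Finset.sum_congr rfl fun a' _ =>
    Finset.sum_congr rfl fun a _ => ?_
  ring

/-- The matrix `⨂ᵢ ρᵢ` on `⨂ᵢ ℂ^{d i}`, whose standard basis is indexed by `∀ i, d i`. -/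
def tensorProd {ι : Type*} [Fintype ι] {d : ι → Type*} (ρ : ∀ i, Matrix (d i) (d i) ℂ) :
    Matrix (∀ i, d i) (∀ i, d i) ℂ :=
  Matrix.of fun a b => ∏ i, ρ i (a i) (b i)

/-- A joint state is separable if it is a convex combination of product states. -/
def IsSeparable {ι : Type*} [Fintype ι] {d : ι → Type*} [∀ i, Fintype (d i)]
    (ρ : Matrix (∀ i, d i) (∀ i, d i) ℂ) : Prop :=
  ρ ∈ convexHull ℝ {τ | ∃ σ : ∀ i, Matrix (d i) (d i) ℂ, (∀ i, IsDensity (σ i)) ∧ τ = tensorProd σ}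

/-- The map `φ ⊗ id_{-i}`: `φ` is applied to each block of `ρ` on the `i`-th factor. -/
def onFactor {ι : Type*} [DecidableEq ι] {d : ι → Type*} (i : ι)
    (φ : Matrix (d i) (d i) ℂ → Matrix (d i) (d i) ℂ)
    (ρ : Matrix (∀ i, d i) (∀ i, d i) ℂ) : Matrix (∀ i, d i) (∀ i, d i) ℂ :=
  Matrix.of fun a b =>
    φ (Matrix.of fun x y => ρ (Function.update a i x) (Function.update b i y)) (a i) (b i)

/-- The replacement channel `X ↦ Tr(X) σ`. -/
def replacement {n : Type*} [Fintype n] (σ : Matrix n n ℂ) (X : Matrix n n ℂ) : Matrix n n ℂ :=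
  X.trace • σ

/-- A quantum game: player `i` holds a register with standard basis `d i` and has a Hermitian
utility tensor `R i` on the joint space. -/
structure QuantumGame (ι : Type*) (d : ι → Type*) where
  R : ι → Matrix (∀ i, d i) (∀ i, d i) ℂ
  herm : ∀ i, (R i).IsHermitian

namespace QuantumGame

variable {ι : Type*} [Fintype ι] [DecidableEq ι] {d : ι → Type*} [∀ i, Fintype (d i)]
  [∀ i, DecidableEq (d i)]

/-- `uᵢ(ρ) = Tr(ρ Rᵢ)` (a real number, as `ρ` and `Rᵢ` are Hermitian). -/
def utility (Γ : QuantumGame ι d) (i : ι) (ρ : Matrix (∀ i, d i) (∀ i, d i) ℂ) : ℝ :=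
  ((ρ * Γ.R i).trace).re

/-- Every utility at a strategy profile (a product state) lies in `[-1, 1]`. -/
def UtilitiesBounded (Γ : QuantumGame ι d) : Prop :=
  ∀ i, ∀ ρ : ∀ j, Matrix (d j) (d j) ℂ, (∀ j, IsDensity (ρ j)) →
    Γ.utility i (tensorProd ρ) ∈ Set.Icc (-1 : ℝ) 1

/-- The super-operator `Θᵢ : L(⨂_{j≠i} ℋⱼ) → L(ℋᵢ)` of `Rᵢ ∈ L(ℋᵢ ⊗ ⨂_{j≠i} ℋⱼ)`. -/
def theta (Γ : QuantumGame ι d) (i : ι) :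
    Matrix (∀ j : {j // j ≠ i}, d j) (∀ j : {j // j ≠ i}, d j) ℂ → Matrix (d i) (d i) ℂ :=
  choiMap (Matrix.reindex (Equiv.piSplitAt i d) (Equiv.piSplitAt i d) (Γ.R i))

/-- The gain matrix `Θᵢ((ρ_{-i})ᵀ)` of player `i` at the profile `ρ`, with
`ρ_{-i} = ⨂_{j≠i} ρⱼ`. -/
def gain (Γ : QuantumGame ι d) (i : ι) (ρ : ∀ j, Matrix (d j) (d j) ℂ) : Matrix (d i) (d i) ℂ :=
  Γ.theta i (tensorProd fun j : {j // j ≠ i} => ρ j).transpose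

/-- `ε`-approximate quantum coarse correlated equilibrium. -/
def IsQCCE (Γ : QuantumGame ι d) (ε : ℝ) (ρ : Matrix (∀ i, d i) (∀ i, d i) ℂ) : Prop :=
  IsDensity ρ ∧ ∀ i, ∀ σ : Matrix (d i) (d i) ℂ, IsDensity σ →
    Γ.utility i ρ ≥ Γ.utility i (onFactor i (replacement σ) ρ) - ε

/-- The product state of the profile `ρ` is an `ε`-approximate quantum Nash equilibrium. -/
def IsQNE (Γ : QuantumGame ι d) (ε : ℝ) (ρ : ∀ i, Matrix (d i) (d i) ℂ) : Prop :=
  (∀ i, IsDensity (ρ i)) ∧ ∀ i, ∀ σ : Matrix (d i) (d i) ℂ, IsDensity σ →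
    Γ.utility i (tensorProd ρ) ≥ Γ.utility i (tensorProd (Function.update ρ i σ)) - ε

end QuantumGame

/-- Matrix Multiplicative Weights Update of one player with fixed stepsize `η`, gain matrices
`G t`, weight matrices `W t` and plays `ρ t` in rounds `t = 1, 2, …` -/
structure IsMMWU {n : Type*} [Fintype n] [DecidableEq n] (η : ℝ)
    (G W ρ : ℕ → Matrix n n ℂ) : Prop where
  init : W 1 = 1
  play : ∀ t, 1 ≤ t → ρ t = (W t).trace⁻¹ • W t
  update : ∀ t, 1 ≤ t → W (t + 1) = NormedSpace.exp (η • ∑ τ ∈ Finset.Icc 1 t, G τ)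

/-- All players of the game `Γ` use MMWU with stepsize `η`; `ρ i t` is the play of player `i` in
round `t`. -/
def QuantumGame.AllMMWU {ι : Type*} [Fintype ι] [DecidableEq ι] {d : ι → Type*}
    [∀ i, Fintype (d i)] [∀ i, DecidableEq (d i)] (Γ : QuantumGame ι d) (η : ℝ)
    (ρ : ∀ i, ℕ → Matrix (d i) (d i) ℂ) : Prop :=
  ∀ i, ∃ W : ℕ → Matrix (d i) (d i) ℂ, IsMMWU η (fun t => Γ.gain i fun j => ρ j t) W (ρ i)

/-- The time average `(1/T) ∑_{t=1}^T ρᵗ`. -/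
noncomputable def timeAvg {n : Type*} (T : ℕ) (ρ : ℕ → Matrix n n ℂ) : Matrix n n ℂ :=
  (T : ℝ)⁻¹ • ∑ t ∈ Finset.Icc 1 T, ρ t

/-- The largest dimension of the players' registers. -/
def maxDim {ι : Type*} [Fintype ι] (d : ι → Type*) [∀ i, Fintype (d i)] : ℕ :=
  Finset.univ.sup fun i => Fintype.card (d i)

/-- A two-player quantum zero-sum game, given by a Hermitian `R ∈ L(𝒜 ⊗ ℬ)`. -/
structure ZeroSumGame (A B : Type*) where
  R : Matrix (A × B) (A × B) ℂ
  herm : R.IsHermitian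

namespace ZeroSumGame

variable {A B : Type*} [Fintype A] [DecidableEq A] [Fintype B] [DecidableEq B]

/-- Alice's payoff `⟨ρ, Θ(σ)⟩`; Bob's payoff is its negative. -/
def payoff (Γ : ZeroSumGame A B) (ρ : Matrix A A ℂ) (σ : Matrix B B ℂ) : ℝ :=
  (hsInner ρ (choiMap Γ.R σ)).re

/-- `u_A(ρ, σ) = -u_B(ρ, σ)` lies in `[-1, 1]` for all strategies. -/
def UtilitiesBounded (Γ : ZeroSumGame A B) : Prop :=
  ∀ ρ σ, IsDensity ρ → IsDensity σ → Γ.payoff ρ σ ∈ Set.Icc (-1 : ℝ) 1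

/-- Both players use MMWU: the gain matrices are `Θ(σᵗ)` for Alice and `-Θ†(ρᵗ)` for Bob. -/
def AllMMWU (Γ : ZeroSumGame A B) (η : ℝ)
    (ρ : ℕ → Matrix A A ℂ) (σ : ℕ → Matrix B B ℂ) : Prop :=
  (∃ W, IsMMWU η (fun t => choiMap Γ.R (σ t)) W ρ) ∧
    ∃ W, IsMMWU η (fun t => -choiAdjoint Γ.R (ρ t)) W σ

/-- `(ρ, σ)` is an `ε`-approximate quantum Nash equilibrium. -/
def IsQNE (Γ : ZeroSumGame A B) (ε : ℝ) (ρ : Matrix A A ℂ) (σ : Matrix B B ℂ) : Prop :=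
  IsDensity ρ ∧ IsDensity σ ∧ (∀ ρ', IsDensity ρ' → Γ.payoff ρ σ ≥ Γ.payoff ρ' σ - ε) ∧
    ∀ σ', IsDensity σ' → -Γ.payoff ρ σ ≥ -Γ.payoff ρ σ' - ε

end ZeroSumGame

/-- A polymatrix quantum game: for an edge `(i, j)`, player `i`'s utility tensor in the two-player
game with `j` is `R i j ∈ L(ℋᵢ ⊗ ℋⱼ)`. -/
structure PolymatrixGame (ι : Type*) (d : ι → Type*) where
  graph : SimpleGraph ι
  R : ∀ i j, Matrix (d i × d j) (d i × d j) ℂ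
  herm : ∀ i j, graph.Adj i j → (R i j).IsHermitian

/-- The reduced state `ρᵢⱼ` on `ℋᵢ ⊗ ℋⱼ` (for `i ≠ j`): all other factors are traced out. -/
def pairMarginal {ι : Type*} [Fintype ι] [DecidableEq ι] {d : ι → Type*} [∀ i, Fintype (d i)]
    [∀ i, DecidableEq (d i)] (i j : ι) (ρ : Matrix (∀ i, d i) (∀ i, d i) ℂ) :
    Matrix (d i × d j) (d i × d j) ℂ :=
  Matrix.of fun x y => ∑ a : ∀ l, d l, if a i = x.1 ∧ a j = x.2 then
    ρ a (Function.update (Function.update a i y.1) j y.2) else 0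

/-- The operator `S ⊗ 1_{-ij}` on the joint space, for `S ∈ L(ℋᵢ ⊗ ℋⱼ)`. -/
def extendPair {ι : Type*} [Fintype ι] [DecidableEq ι] {d : ι → Type*}
    [∀ i, DecidableEq (d i)] (i j : ι) (S : Matrix (d i × d j) (d i × d j) ℂ) :
    Matrix (∀ i, d i) (∀ i, d i) ℂ :=
  Matrix.of fun a b => if ∀ l, l ≠ i → l ≠ j → a l = b l then S (a i, a j) (b i, b j) else 0

namespace PolymatrixGame

variable {ι : Type*} [Fintype ι] [DecidableEq ι] {d : ι → Type*} [∀ i, Fintype (d i)]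
  [∀ i, DecidableEq (d i)]

open Classical in
/-- `uᵢ(ρ) = ∑_{(i,j) ∈ E} Tr(ρᵢⱼ Rᵢⱼ)`. -/
noncomputable def utility (P : PolymatrixGame ι d) (i : ι)
    (ρ : Matrix (∀ i, d i) (∀ i, d i) ℂ) : ℝ :=
  ∑ j with P.graph.Adj i j, ((pairMarginal i j ρ * P.R i j).trace).re

/-- The (global) zero-sum property. -/
def IsZeroSum (P : PolymatrixGame ι d) : Prop :=
  ∀ ρ : Matrix (∀ i, d i) (∀ i, d i) ℂ, IsDensity ρ → ∑ i, P.utility i ρ = 0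

open Classical in
/-- The polymatrix game as a quantum game, with utility tensors
`Rᵢ = ∑_{(i,j) ∈ E} Rᵢⱼ ⊗ 1_{-ij}`. -/
noncomputable def toGame (P : PolymatrixGame ι d) : QuantumGame ι d where
  R i := ∑ j with P.graph.Adj i j, extendPair i j (P.R i j)
  herm i := by
    unfold Matrix.IsHermitian
    rw [Matrix.conjTranspose_sum]
    refine Finset.sum_congr rfl fun j hj => ?_
    have h := P.herm i j (Finset.mem_filter.1 hj).2
    ext a b
    simp only [extendPair, Matrix.conjTranspose_apply, Matrix.of_apply]
    have e : (∀ l, l ≠ i → l ≠ j → b l = a l) ↔ ∀ l, l ≠ i → l ≠ j → a l = b l :=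
      ⟨fun h l h1 h2 => (h l h1 h2).symm, fun h l h1 h2 => (h l h1 h2).symm⟩
    by_cases hc : ∀ l, l ≠ i → l ≠ j → a l = b l
    · rw [if_pos (e.2 hc), if_pos hc, h.apply]
    · rw [if_neg (fun h => hc (e.1 h)), if_neg hc, star_zero]

theorem trace_pairMarginal_mul {i j : ι} (hij : i ≠ j)
    (ρ : Matrix (∀ i, d i) (∀ i, d i) ℂ) (S : Matrix (d i × d j) (d i × d j) ℂ) :
    (pairMarginal i j ρ * S).trace = (ρ * extendPair i j S).trace := by
  have key : ∀ a : ∀ l, d l, (∑ b, ρ a b * extendPair i j S b a) =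
      ∑ y : d i × d j,
        ρ a (Function.update (Function.update a i y.1) j y.2) * S y (a i, a j) := by
    intro a
    let g : d i × d j → ∀ l, d l := fun y => Function.update (Function.update a i y.1) j y.2
    have hinj : Function.Injective g := by
      intro y z h
      have h1 := congrFun h i
      have h2 := congrFun h j
      simp only [g, Function.update_self, Function.update_of_ne hij] at h1 h2
      exact Prod.ext h1 h2
    have himg := Finset.sum_image (s := Finset.univ)
      (f := fun b : ∀ l, d l => ρ a b * S (b i, b j) (a i, a j)) (g := g) hinj.injOn
    refine Eq.trans (Eq.trans ?_ himg) ?_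
    · symm
      apply Finset.sum_subset_zero_on_sdiff (Finset.subset_univ _)
      · intro b hb
        have hne : ¬ ∀ l, l ≠ i → l ≠ j → b l = a l := by
          intro h
          apply (Finset.mem_sdiff.1 hb).2
          refine Finset.mem_image.2 ⟨(b i, b j), Finset.mem_univ _, ?_⟩
          funext l
          by_cases hj : l = j
          · subst hj; simp [g]
          by_cases hi : l = i
          · subst hi; simp [g, Function.update_of_ne hij]
          simp [g, hi, hj, h l hi hj]
        simp [extendPair, hne]
      · intro b hb
        obtain ⟨y, -, rfl⟩ := Finset.mem_image.1 hb
        have : ∀ l, l ≠ i → l ≠ j → g y l = a l := by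
          intro l hi hj
          simp [g, hi, hj]
        simp only [extendPair, Matrix.of_apply]
        rw [if_pos this]
    · refine Finset.sum_congr rfl fun y _ => ?_
      simp [g, Function.update_of_ne hij]
  simp only [Matrix.trace, Matrix.diag_apply, Matrix.mul_apply, key]
  simp only [pairMarginal, Matrix.of_apply, Finset.sum_mul]
  rw [Finset.sum_congr rfl fun x _ => Finset.sum_comm, Finset.sum_comm]
  refine Finset.sum_congr rfl fun a _ => ?_
  rw [Finset.sum_eq_single (a i, a j)]
  · simp
  · rintro ⟨x1, x2⟩ - hx
    refine Finset.sum_eq_zero fun y _ => ?_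
    rw [if_neg, zero_mul]
    rintro ⟨h1, h2⟩
    exact hx (Prod.ext h1.symm h2.symm)
  · intro h
    exact absurd (Finset.mem_univ _) h

/-- The quantum game `P.toGame` has the same utilities as the polymatrix game `P`. -/
theorem toGame_utility (P : PolymatrixGame ι d) (i : ι)
    (ρ : Matrix (∀ i, d i) (∀ i, d i) ℂ) : P.toGame.utility i ρ = P.utility i ρ := by
  classical
  simp only [QuantumGame.utility, utility, toGame, Matrix.mul_sum, Matrix.trace_sum,
    Complex.re_sum]
  refine Finset.sum_congr (by congr) fun j hj => ?_
  rw [trace_pairMarginal_mul (Finset.mem_filter.1 hj).2.ne]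

end PolymatrixGame

end QGame

/-! All three parts rest on one regret bound for a single MMWU player, `IsMMWU.regret_le`. The
potential is log Tr W. It starts at log n and, by `re_trace_mul_le_log_trace_exp`, finally dominates
η times the total gain of any fixed state. `IsMMWU.re_trace_weight_le` shows that each round raises
it by at most η times the realised gain plus η². So the averaged regret is at most ln n / (ηT) + η,
which is at most 2η once ln n ≤ η²T.

The one-round estimate does not use Golden–Thompson. Each trace in `re_trace_exp_le` expands over
pairs (eigenvalue of X, eigenvalue of Y) with the same nonnegative weights `overlap`, so a scalar
inequality, `exp_le_exp_add`, suffices.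

A player's gain matrix represents the linear functional "utility of a unilateral deviation"
(`trace_mul_gain`), so regret compares actual play with fixed deviations. For general games, a
replacement channel acts on the averaged state as the average of such deviations, which is the QCCE
condition. For zero-sum games, utilities are affine in the opponents' averages once the own state is
fixed, and adding the players' regrets cancels the realised utilities. -/

namespace QGame

section

open Matrix Finset

/-! ### Spectral calculus and traces of two noncommuting Hermitian matrices -/

section Spectral

variable {n : Type*} [Fintype n] [DecidableEq n]

/-- The Hermitian matrix `U diag(f) U†`. -/
noncomputable def conjDiag (U : unitaryGroup n ℂ) (f : n → ℝ) : Matrix n n ℂ :=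
  (U : Matrix n n ℂ) * diagonal (fun i => (f i : ℂ)) * (U : Matrix n n ℂ)ᴴ

theorem exists_eq_conjDiag {X : Matrix n n ℂ} (hX : X.IsHermitian) :
    ∃ U x, X = conjDiag U x :=
  ⟨hX.eigenvectorUnitary, hX.eigenvalues, by
    conv_lhs => rw [hX.spectral_theorem]
    rfl⟩

theorem conjTranspose_mul_coe_unitaryGroup (U : unitaryGroup n ℂ) :
    (U : Matrix n n ℂ)ᴴ * (U : Matrix n n ℂ) = 1 :=
  UnitaryGroup.star_mul_self U

theorem coe_unitaryGroup_mul_conjTranspose (U : unitaryGroup n ℂ) :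
    (U : Matrix n n ℂ) * (U : Matrix n n ℂ)ᴴ = 1 :=
  mul_eq_one_comm.1 (conjTranspose_mul_coe_unitaryGroup U)

theorem conjDiag_mul (U : unitaryGroup n ℂ) (f g : n → ℝ) :
    conjDiag U f * conjDiag U g = conjDiag U fun i => f i * g i := by
  simp only [conjDiag]
  calc _ = (U : Matrix n n ℂ) * diagonal (fun i => (f i : ℂ)) *
        ((U : Matrix n n ℂ)ᴴ * (U : Matrix n n ℂ)) * diagonal (fun i => (g i : ℂ)) *
        (U : Matrix n n ℂ)ᴴ := by simp only [Matrix.mul_assoc]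
    _ = _ := by
      rw [conjTranspose_mul_coe_unitaryGroup, Matrix.mul_one, Matrix.mul_assoc _ (diagonal _)
        (diagonal _), diagonal_mul_diagonal]
      simp

theorem conjDiag_one (U : unitaryGroup n ℂ) : conjDiag U (fun _ => 1) = 1 := by
  simp [conjDiag, coe_unitaryGroup_mul_conjTranspose]

theorem exp_conjDiag (U : unitaryGroup n ℂ) (f : n → ℝ) :
    NormedSpace.exp (conjDiag U f) = conjDiag U fun i => Real.exp (f i) := by
  have hinv : (U : Matrix n n ℂ)⁻¹ = (U : Matrix n n ℂ)ᴴ :=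
    inv_eq_left_inv (conjTranspose_mul_coe_unitaryGroup U)
  have hu : IsUnit (U : Matrix n n ℂ) :=
    IsUnit.of_mul_eq_one _ (coe_unitaryGroup_mul_conjTranspose U)
  simp only [conjDiag]
  rw [← hinv, exp_conj _ _ hu, exp_diagonal]
  congr 3
  funext i
  rw [Pi.coe_exp, ← Complex.exp_eq_exp_ℂ, Complex.ofReal_exp]

theorem conjDiag_posSemidef (U : unitaryGroup n ℂ) {f : n → ℝ} (hf : ∀ i, 0 ≤ f i) :
    (conjDiag U f).PosSemidef :=
  (PosSemidef.diagonal fun i => by simpa using hf i).mul_mul_conjTranspose_same _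

/-- The squared modulus of the inner product of the `i`-th column of `U` with the `j`-th column
of `V`. -/
noncomputable def overlap (U V : unitaryGroup n ℂ) (i j : n) : ℝ :=
  Complex.normSq (((U : Matrix n n ℂ)ᴴ * (V : Matrix n n ℂ)) i j)

theorem overlap_nonneg (U V : unitaryGroup n ℂ) (i j : n) : 0 ≤ overlap U V i j :=
  Complex.normSq_nonneg _

/-- With M = U†V, cyclicity turns the trace into Tr(D_f M D_g M†), whose weights are |M i j|². The
weights do not depend on f and g, so a pointwise inequality between combinations of products
f(x)g(y) passes to traces. -/
theorem re_trace_conjDiag_mul (U V : unitaryGroup n ℂ) (f g : n → ℝ) :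
    (conjDiag U f * conjDiag V g).trace.re = ∑ i, ∑ j, overlap U V i j * (f i * g j) := by
  set M : Matrix n n ℂ := (U : Matrix n n ℂ)ᴴ * (V : Matrix n n ℂ) with hM
  have h : (conjDiag U f * conjDiag V g).trace =
      (diagonal (fun i => (f i : ℂ)) * M * diagonal (fun i => (g i : ℂ)) * Mᴴ).trace := by
    simp only [conjDiag, hM, conjTranspose_mul, conjTranspose_conjTranspose]
    rw [Matrix.mul_assoc, Matrix.mul_assoc, trace_mul_comm]
    simp only [Matrix.mul_assoc]
  rw [h, trace, Complex.re_sum]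
  refine sum_congr rfl fun i _ => ?_
  rw [diag_apply, mul_apply, Complex.re_sum]
  refine sum_congr rfl fun j _ => ?_
  rw [mul_diagonal, diagonal_mul, conjTranspose_apply, overlap, ← hM]
  have : (f i : ℂ) * M i j * (g j : ℂ) * star (M i j) =
      ((Complex.normSq (M i j) * (f i * g j) : ℝ) : ℂ) := by
    have e := Complex.mul_conj (M i j)
    push_cast
    rw [← e, starRingEnd_apply]
    ring
  rw [this, Complex.ofReal_re]

theorem re_trace_conjDiag (U V : unitaryGroup n ℂ) (f : n → ℝ) :
    (conjDiag U f).trace.re = ∑ i, ∑ j, overlap U V i j * f i := by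
  have := re_trace_conjDiag_mul U V f fun _ => 1
  simpa [conjDiag_one] using this

theorem re_trace_conjDiag' (U V : unitaryGroup n ℂ) (g : n → ℝ) :
    (conjDiag V g).trace.re = ∑ i, ∑ j, overlap U V i j * g j := by
  have := re_trace_conjDiag_mul U V (fun _ => 1) g
  simpa [conjDiag_one] using this

theorem posSemidef_exp {X : Matrix n n ℂ} (hX : X.IsHermitian) :
    (NormedSpace.exp X).PosSemidef := by
  obtain ⟨U, x, rfl⟩ := exists_eq_conjDiag hX
  rw [exp_conjDiag]
  exact conjDiag_posSemidef U fun i => (Real.exp_pos _).le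

end Spectral

/-! ### The scalar exponential inequality -/

/-- After multiplication by e^(-t) the claim is p ≥ 1 = p 0, and p' = (t/2)(1 - t e^(-t)) has the
sign of t. -/
theorem exp_sub_one_sub_le (t : ℝ) :
    Real.exp t - 1 - t ≤ t ^ 2 / 2 + t ^ 2 / 4 * Real.exp t := by
  set p : ℝ → ℝ := fun t => (1 + t + t ^ 2 / 2) * Real.exp (-t) + t ^ 2 / 4 with hp
  have hd : ∀ t, HasDerivAt p (t / 2 * (1 - t * Real.exp (-t))) t := by
    intro t
    have h1 : HasDerivAt (fun t : ℝ => 1 + t + t ^ 2 / 2) (1 + t) t := by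
      have := ((hasDerivAt_id t).const_add 1).add ((hasDerivAt_pow 2 t).div_const 2)
      refine this.congr_deriv ?_
      push_cast
      ring
    have h2 : HasDerivAt (fun t : ℝ => Real.exp (-t)) (-Real.exp (-t)) t := by
      simpa using (hasDerivAt_id t).neg.exp
    have := (h1.mul h2).add ((hasDerivAt_pow 2 t).div_const 4)
    refine this.congr_deriv ?_
    push_cast
    ring
  have hc : Continuous p := continuous_iff_continuousAt.2 fun t => (hd t).continuousAt
  have hle : ∀ t : ℝ, 0 ≤ 1 - t * Real.exp (-t) := by
    intro t
    have h1 := Real.add_one_le_exp t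
    have h2 : Real.exp t * Real.exp (-t) = 1 := by rw [← Real.exp_add]; simp
    nlinarith [Real.exp_pos (-t)]
  have h1 : 1 ≤ p t := by
    have p0 : p 0 = 1 := by simp [hp]
    rcases le_total 0 t with ht | ht
    · have := monotoneOn_of_deriv_nonneg (convex_Ici (0 : ℝ)) hc.continuousOn
        (fun x _ => (hd x).differentiableAt.differentiableWithinAt) fun x hx => by
          rw [interior_Ici] at hx
          rw [(hd x).deriv]
          exact mul_nonneg (half_pos hx).le (hle x)
      simpa [p0] using this Set.self_mem_Ici ht ht
    · have := antitoneOn_of_deriv_nonpos (convex_Iic (0 : ℝ)) hc.continuousOn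
        (fun x _ => (hd x).differentiableAt.differentiableWithinAt) fun x hx => by
          rw [interior_Iic] at hx
          rw [(hd x).deriv]
          exact mul_nonpos_of_nonpos_of_nonneg (div_nonpos_of_nonpos_of_nonneg (le_of_lt hx) zero_le_two) (hle x)
      simpa [p0] using this ht Set.self_mem_Iic ht
  have h2 : Real.exp (-t) * Real.exp t = 1 := by rw [← Real.exp_add]; simp
  have h3 : p t * Real.exp t = 1 + t + t ^ 2 / 2 + t ^ 2 / 4 * Real.exp t := by
    simp only [hp]
    linear_combination (1 + t + t ^ 2 / 2) * h2
  nlinarith [Real.exp_pos t]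

/-- The remainder is shared between e^x and e^y, so every term is a combination of products of a
function of x and a function of y, as the double spectral sum requires. -/
theorem exp_le_exp_add (x y : ℝ) :
    Real.exp y ≤ Real.exp x + (y - x) * Real.exp x + (y - x) ^ 2 / 2 * Real.exp x +
      (y - x) ^ 2 / 4 * Real.exp y := by
  have h := exp_sub_one_sub_le (y - x)
  have e : Real.exp x * Real.exp (y - x) = Real.exp y := by rw [← Real.exp_add]; simp
  have := mul_le_mul_of_nonneg_left h (Real.exp_pos x).le
  nlinarith

/-! ### Trace inequalities for the matrix exponential -/

section TraceExp

variable {n : Type*} [Fintype n] [DecidableEq n]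

/-- A second-order bound for `Tr e^Y` around `X`. -/
theorem re_trace_exp_le {X Y : Matrix n n ℂ} (hX : X.IsHermitian) (hY : Y.IsHermitian) :
    (NormedSpace.exp Y).trace.re ≤ (NormedSpace.exp X).trace.re +
      ((Y - X) * NormedSpace.exp X).trace.re +
      ((Y - X) * (Y - X) * NormedSpace.exp X).trace.re / 2 +
      ((Y - X) * (Y - X) * NormedSpace.exp Y).trace.re / 4 := by
  obtain ⟨U, x, rfl⟩ := exists_eq_conjDiag hX
  obtain ⟨V, y, rfl⟩ := exists_eq_conjDiag hY
  simp only [exp_conjDiag]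
  set X := conjDiag U x with hXd
  set Y := conjDiag V y with hYd
  set EX := conjDiag U fun i => Real.exp (x i) with hEX
  set EY := conjDiag V fun i => Real.exp (y i) with hEY
  -- Up to cyclic rotation, every monomial in the three correction terms is a function of X times a
  -- function of Y: only one exponential occurs, and it commutes with one of the two matrices.
  have e1 : ((Y - X) * EX).trace.re =
      ∑ i, ∑ j, overlap U V i j * ((y j - x i) * Real.exp (x i)) := by
    have : ((Y - X) * EX).trace = (EX * Y).trace - (X * EX).trace := by
      rw [Matrix.sub_mul, trace_sub, trace_mul_comm Y]
    rw [this, Complex.sub_re, hXd, hEX, hYd, conjDiag_mul, re_trace_conjDiag_mul,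
      re_trace_conjDiag U V]
    simp only [← sum_sub_distrib]
    refine sum_congr rfl fun i _ => sum_congr rfl fun j _ => by ring
  have e2 : ((Y - X) * (Y - X) * EX).trace.re =
      ∑ i, ∑ j, overlap U V i j * ((y j - x i) ^ 2 * Real.exp (x i)) := by
    have : ((Y - X) * (Y - X) * EX).trace =
        (EX * (Y * Y)).trace - (X * EX * Y).trace - (EX * X * Y).trace + (X * X * EX).trace := by
      have a1 : (Y * X * EX).trace = (X * EX * Y).trace := by
        rw [Matrix.mul_assoc, trace_mul_comm]
      have a2 : (X * Y * EX).trace = (EX * X * Y).trace := by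
        rw [trace_mul_comm, Matrix.mul_assoc]
      rw [← a1, ← a2, trace_mul_comm EX]
      simp only [Matrix.sub_mul, Matrix.mul_sub, trace_sub]
      ring
    rw [this]
    simp only [Complex.add_re, Complex.sub_re, hXd, hEX, hYd, conjDiag_mul, re_trace_conjDiag_mul,
      re_trace_conjDiag U V]
    simp only [← sum_sub_distrib, ← sum_add_distrib]
    refine sum_congr rfl fun i _ => sum_congr rfl fun j _ => by ring
  have e3 : ((Y - X) * (Y - X) * EY).trace.re =
      ∑ i, ∑ j, overlap U V i j * ((y j - x i) ^ 2 * Real.exp (y j)) := by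
    have : ((Y - X) * (Y - X) * EY).trace =
        (Y * Y * EY).trace - (X * (EY * Y)).trace - (X * (Y * EY)).trace + (X * X * EY).trace := by
      have a1 : (Y * X * EY).trace = (X * (EY * Y)).trace := by
        rw [Matrix.mul_assoc, trace_mul_comm, Matrix.mul_assoc]
      rw [← a1, ← Matrix.mul_assoc X]
      simp only [Matrix.sub_mul, Matrix.mul_sub, trace_sub]
      ring
    rw [this]
    simp only [Complex.add_re, Complex.sub_re, hXd, hEY, hYd, conjDiag_mul, re_trace_conjDiag_mul,
      re_trace_conjDiag' U V]
    simp only [← sum_sub_distrib, ← sum_add_distrib]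
    refine sum_congr rfl fun i _ => sum_congr rfl fun j _ => by ring
  rw [e1, e2, e3, hEX, hEY, re_trace_conjDiag U V, re_trace_conjDiag' U V]
  simp only [sum_div, ← sum_add_distrib]
  refine sum_le_sum fun i _ => sum_le_sum fun j _ => ?_
  nlinarith [mul_le_mul_of_nonneg_left (exp_le_exp_add (x i) (y j)) (overlap_nonneg U V i j)]

/-- Eigenprojections serve as test states: they turn a bound on expectations into a bound on
eigenvalues. -/
theorem IsDensity.conjDiag_pi_single (U : unitaryGroup n ℂ) (k : n) :
    IsDensity (conjDiag U (Pi.single k 1)) := by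
  refine ⟨conjDiag_posSemidef U fun i => ?_, ?_⟩
  · by_cases h : i = k
    · subst h; simp
    · simp [h]
  · rw [conjDiag, trace_mul_comm, ← Matrix.mul_assoc, conjTranspose_mul_coe_unitaryGroup,
      Matrix.one_mul, trace_diagonal, ← Complex.ofReal_sum]
    simp

theorem re_trace_eq_sum_diag (U : unitaryGroup n ℂ) (f : n → ℝ) (M : Matrix n n ℂ) :
    (M * conjDiag U f).trace.re =
      ∑ i, f i * (((U : Matrix n n ℂ)ᴴ * M * (U : Matrix n n ℂ)) i i).re := by
  rw [conjDiag, ← Matrix.mul_assoc, trace_mul_comm, ← Matrix.mul_assoc, ← Matrix.mul_assoc,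
    trace, Complex.re_sum]
  refine sum_congr rfl fun i _ => ?_
  rw [diag_apply, mul_diagonal, mul_comm, Complex.re_ofReal_mul]

theorem re_diag_conj_nonneg {M : Matrix n n ℂ} (hM : M.PosSemidef) (U : unitaryGroup n ℂ) (i : n) :
    0 ≤ (((U : Matrix n n ℂ)ᴴ * M * (U : Matrix n n ℂ)) i i).re :=
  (Complex.le_def.1 (hM.conjTranspose_mul_mul_same (U : Matrix n n ℂ)).diag_nonneg).1

/-- A Hermitian `G` whose expectation lies in `[-1, 1]` in every state has `G² ≤ 1`. -/
theorem re_trace_sq_mul_le {G M : Matrix n n ℂ} (hG : G.IsHermitian)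
    (hb : ∀ σ, IsDensity σ → (σ * G).trace.re ∈ Set.Icc (-1 : ℝ) 1) (hM : M.PosSemidef) :
    (G * G * M).trace.re ≤ M.trace.re := by
  obtain ⟨U, g, rfl⟩ := exists_eq_conjDiag hG
  have hg : ∀ k, g k * g k ≤ 1 := by
    intro k
    have h := hb _ (IsDensity.conjDiag_pi_single U k)
    rw [re_trace_conjDiag_mul] at h
    -- The overlaps of an eigenbasis with itself form the identity matrix.
    have hk : (∑ i, ∑ j, overlap U U i j * ((Pi.single k 1 : n → ℝ) i * g j)) = g k := by
      simp [overlap, conjTranspose_mul_coe_unitaryGroup, Matrix.one_apply, Pi.single_apply]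
    rw [hk] at h
    nlinarith [h.1, h.2]
  have h1 : M.trace.re = (M * conjDiag U fun _ => 1).trace.re := by simp [conjDiag_one]
  rw [conjDiag_mul, trace_mul_comm, h1, re_trace_eq_sum_diag, re_trace_eq_sum_diag]
  exact sum_le_sum fun i _ => mul_le_mul_of_nonneg_right (hg i) (re_diag_conj_nonneg hM U i)

/-- Each eigenvalue of X is at most log ∑ e^(x i), and the left side is an average of eigenvalues,
weighted by the diagonal of σ in the eigenbasis. -/
theorem re_trace_mul_le_log_trace_exp {σ X : Matrix n n ℂ} (hσ : IsDensity σ)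
    (hX : X.IsHermitian) :
    (σ * X).trace.re ≤ Real.log (NormedSpace.exp X).trace.re := by
  obtain ⟨U, x, rfl⟩ := exists_eq_conjDiag hX
  rw [exp_conjDiag]
  set Z := (conjDiag U fun i => Real.exp (x i)).trace.re with hZ
  have hZs : Z = ∑ i, Real.exp (x i) := by
    rw [hZ, re_trace_conjDiag U U]
    simp [overlap, conjTranspose_mul_coe_unitaryGroup, Matrix.one_apply]
  have hx : ∀ i, x i ≤ Real.log Z := by
    intro i
    have hi : Real.exp (x i) ≤ Z :=
      hZs ▸ single_le_sum (f := fun i => Real.exp (x i)) (fun j _ => (Real.exp_pos _).le)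
        (mem_univ i)
    exact (Real.le_log_iff_exp_le ((Real.exp_pos _).trans_le hi)).2 hi
  have h1 : (σ * conjDiag U fun _ => 1).trace.re = 1 := by simp [conjDiag_one, hσ.2]
  rw [re_trace_eq_sum_diag] at h1 ⊢
  calc _ ≤ ∑ i, Real.log Z * (((U : Matrix n n ℂ)ᴴ * σ * (U : Matrix n n ℂ)) i i).re :=
        sum_le_sum fun i _ => mul_le_mul_of_nonneg_right (hx i) (re_diag_conj_nonneg hσ.1 U i)
    _ = Real.log Z := by
      rw [← mul_sum]
      simp only [one_mul] at h1
      rw [h1, mul_one]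

theorem trace_exp_pos [Nonempty n] {X : Matrix n n ℂ} (hX : X.IsHermitian) :
    0 < (NormedSpace.exp X).trace := by
  obtain ⟨U, x, rfl⟩ := exists_eq_conjDiag hX
  rw [exp_conjDiag, conjDiag, trace_mul_comm, ← Matrix.mul_assoc,
    conjTranspose_mul_coe_unitaryGroup, Matrix.one_mul, trace_diagonal, ← Complex.ofReal_sum]
  exact_mod_cast sum_pos (fun i _ => Real.exp_pos (x i)) univ_nonempty

end TraceExp

/-! ### Regret of a single MMWU player -/

section MMWU

theorem isHermitian_smul_sum {n : Type*} {G : ℕ → Matrix n n ℂ} (η : ℝ) {t : ℕ}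
    (hG : ∀ τ, 1 ≤ τ → τ ≤ t → (G τ).IsHermitian) :
    (η • ∑ τ ∈ Icc 1 t, G τ).IsHermitian := by
  have : (∑ τ ∈ Icc 1 t, G τ).IsHermitian := by
    unfold Matrix.IsHermitian
    rw [conjTranspose_sum]
    exact sum_congr rfl fun τ hτ => hG τ (mem_Icc.1 hτ).1 (mem_Icc.1 hτ).2
  unfold Matrix.IsHermitian
  rw [conjTranspose_smul, this.eq, star_trivial]

variable {n : Type*} [Fintype n] [DecidableEq n] {η : ℝ} {G W ρ : ℕ → Matrix n n ℂ}

/-- At t = 0 the empty sum gives exp 0 = 1, so the initial weight needs no separate treatment. -/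
theorem IsMMWU.weight_eq (h : IsMMWU η G W ρ) (t : ℕ) :
    W (t + 1) = NormedSpace.exp (η • ∑ τ ∈ Icc 1 t, G τ) := by
  rcases Nat.eq_zero_or_pos t with rfl | ht
  · simp [h.init]
  · exact h.update t ht

/-- Only gains of earlier rounds are assumed Hermitian. This permits a simultaneous induction over
all players, whose gains depend on each other's plays. -/
theorem IsMMWU.isDensity_play [Nonempty n] (h : IsMMWU η G W ρ) {t : ℕ} (ht : 1 ≤ t)
    (hG : ∀ τ, 1 ≤ τ → τ < t → (G τ).IsHermitian) : IsDensity (ρ t) := by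
  obtain ⟨s, rfl⟩ := Nat.exists_eq_add_of_le' ht
  have hH := isHermitian_smul_sum η (t := s) fun τ h1 h2 => hG τ h1 (Nat.lt_succ_of_le h2)
  have hpos := trace_exp_pos hH
  rw [h.play _ ht, h.weight_eq]
  refine ⟨(posSemidef_exp hH).smul (inv_nonneg.2 hpos.le), ?_⟩
  rw [trace_smul, smul_eq_mul, inv_mul_cancel₀ hpos.ne']

/-- Consecutive exponents differ by ηG, so `re_trace_exp_le` applies; its linear term is the
realised gain, and G² ≤ 1 bounds the quadratic ones. -/
theorem IsMMWU.re_trace_weight_le [Nonempty n] (h : IsMMWU η G W ρ) (h0 : 0 < η) (h1 : η ≤ 1)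
    (hG : ∀ t, 1 ≤ t → (G t).IsHermitian)
    (hb : ∀ t, 1 ≤ t → ∀ σ, IsDensity σ → (σ * G t).trace.re ∈ Set.Icc (-1 : ℝ) 1) (t : ℕ) :
    (W (t + 2)).trace.re ≤ (W (t + 1)).trace.re *
      Real.exp (η * (ρ (t + 1) * G (t + 1)).trace.re + η ^ 2) := by
  have hX := isHermitian_smul_sum η (t := t) fun τ h1 _ => hG τ h1
  have hY := isHermitian_smul_sum η (t := t + 1) fun τ h1 _ => hG τ h1
  have hd : (η • ∑ τ ∈ Icc 1 (t + 1), G τ) - η • ∑ τ ∈ Icc 1 t, G τ = η • G (t + 1) := by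
    rw [sum_Icc_succ_top (by omega), smul_add, add_sub_cancel_left]
  have key := re_trace_exp_le hX hY
  rw [hd, ← h.weight_eq, ← h.weight_eq] at key
  have hZ : 0 < (W (t + 1)).trace := h.weight_eq t ▸ trace_exp_pos hX
  have hWX : (W (t + 1)).PosSemidef := h.weight_eq t ▸ posSemidef_exp hX
  have hWY : (W (t + 2)).PosSemidef := h.weight_eq (t + 1) ▸ posSemidef_exp hY
  have hGt := hG (t + 1) (by omega)
  have hbt := hb (t + 1) (by omega)
  have qX := re_trace_sq_mul_le hGt hbt hWX
  have qY := re_trace_sq_mul_le hGt hbt hWY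
  have hZre : 0 < (W (t + 1)).trace.re := (Complex.lt_def.1 hZ).1
  have hZeq : (W (t + 1)).trace = ((W (t + 1)).trace.re : ℂ) :=
    Complex.ext rfl (Complex.lt_def.1 hZ).2.symm
  have hlin : (G (t + 1) * W (t + 1)).trace.re =
      (W (t + 1)).trace.re * (ρ (t + 1) * G (t + 1)).trace.re := by
    rw [← Complex.re_ofReal_mul, ← hZeq, h.play _ (by omega), smul_mul, trace_smul, smul_eq_mul,
      mul_inv_cancel_left₀ hZ.ne', trace_mul_comm]
  simp only [smul_mul_assoc, mul_smul_comm, trace_smul, Complex.smul_re, smul_eq_mul, hlin] at key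
  set Z := (W (t + 1)).trace.re
  set Z' := (W (t + 2)).trace.re
  set g := (ρ (t + 1) * G (t + 1)).trace.re
  have hη : 0 ≤ η * η := mul_self_nonneg η
  have hη1 : η * η ≤ 1 := by nlinarith
  -- The remainder at the new weight is moved to the left side.
  have step : Z' * (1 - η * η / 4) ≤ Z * (1 + (η * g + η * η / 2)) := by nlinarith
  have e1 : 1 + (η * g + η * η / 2) ≤ Real.exp (η * g + η * η / 2) := by
    linarith [Real.add_one_le_exp (η * g + η * η / 2)]
  -- With s = η²/2 ≤ 1/2, (1 - s/2)(1 + s) ≥ 1. This factor costs the second η²/2 in the exponent.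
  have e2 : 1 ≤ (1 - η * η / 4) * Real.exp (η * η / 2) := by
    have := Real.add_one_le_exp (η * η / 2)
    nlinarith
  have hZ' : 0 ≤ Z' := (Complex.le_def.1 hWY.trace_nonneg).1
  calc Z' ≤ Z' * ((1 - η * η / 4) * Real.exp (η * η / 2)) := le_mul_of_one_le_right hZ' e2
    _ = Z' * (1 - η * η / 4) * Real.exp (η * η / 2) := by ring
    _ ≤ Z * Real.exp (η * g + η * η / 2) * Real.exp (η * η / 2) :=
      mul_le_mul_of_nonneg_right (step.trans (mul_le_mul_of_nonneg_left e1 hZre.le))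
        (Real.exp_pos _).le
    _ = Z * Real.exp (η * g + η ^ 2) := by
      rw [mul_assoc, ← Real.exp_add]
      ring_nf

/-- The regret bound of MMWU. -/
theorem IsMMWU.regret_le [Nonempty n] (h : IsMMWU η G W ρ) (h0 : 0 < η) (h1 : η ≤ 1)
    (hG : ∀ t, 1 ≤ t → (G t).IsHermitian)
    (hb : ∀ t, 1 ≤ t → ∀ σ, IsDensity σ → (σ * G t).trace.re ∈ Set.Icc (-1 : ℝ) 1) (T : ℕ)
    {σ : Matrix n n ℂ} (hσ : IsDensity σ) :
    η * ∑ t ∈ Icc 1 T, (σ * G t).trace.re ≤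
      Real.log (Fintype.card n) + η * ∑ t ∈ Icc 1 T, (ρ t * G t).trace.re + η ^ 2 * T := by
  have hH := fun t => isHermitian_smul_sum η (t := t) fun τ h1 _ => hG τ h1
  have hpos : ∀ t, 0 < (W (t + 1)).trace.re := fun t =>
    h.weight_eq t ▸ (Complex.lt_def.1 (trace_exp_pos (hH t))).1
  have pot : ∀ t, Real.log (W (t + 1)).trace.re ≤
      Real.log (Fintype.card n) + η * ∑ t ∈ Icc 1 t, (ρ t * G t).trace.re + η ^ 2 * t := by
    intro t
    induction t with
    -- The dimension enters here, as log Tr 1.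
    | zero => simp [h.init]
    | succ t ih =>
      have := Real.log_le_log (hpos (t + 1)) (h.re_trace_weight_le h0 h1 hG hb t)
      rw [Real.log_mul (hpos t).ne' (Real.exp_pos _).ne', Real.log_exp] at this
      rw [sum_Icc_succ_top (by omega)]
      push_cast
      linarith
  refine le_trans ?_ (pot T)
  rw [h.weight_eq]
  refine le_trans (le_of_eq ?_) (re_trace_mul_le_log_trace_exp hσ (hH T))
  rw [mul_smul_comm, trace_smul, Complex.smul_re, smul_eq_mul, Matrix.mul_sum, trace_sum,
    Complex.re_sum]

end MMWU

/-- One η²T is the second-order loss; the other bounds ln n. -/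
theorem avg_le_avg_add {η a b : ℝ} {T : ℕ} (hη : 0 < η) (hT : 1 ≤ T)
    (h : η * a ≤ η ^ 2 * T + η * b + η ^ 2 * T) : (T : ℝ)⁻¹ * a ≤ (T : ℝ)⁻¹ * b + 2 * η := by
  have hT' : (0 : ℝ) < T := by exact_mod_cast hT
  have h1 : a ≤ b + 2 * η * T := le_of_mul_le_mul_left (by linarith) hη
  calc (T : ℝ)⁻¹ * a ≤ (T : ℝ)⁻¹ * (b + 2 * η * T) := by gcongr
    _ = (T : ℝ)⁻¹ * b + 2 * η := by field_simp

/-! ### Time averages -/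

section TimeAvg

variable {m n : Type*}

theorem conjTranspose_timeAvg (T : ℕ) (ρ : ℕ → Matrix n n ℂ) :
    (timeAvg T ρ)ᴴ = timeAvg T fun t => (ρ t)ᴴ := by
  rw [timeAvg, timeAvg, conjTranspose_smul, conjTranspose_sum, star_trivial]

theorem re_trace_mul_timeAvg [Fintype n] (T : ℕ) (M : Matrix n n ℂ) (ρ : ℕ → Matrix n n ℂ) :
    (M * timeAvg T ρ).trace.re = (T : ℝ)⁻¹ * ∑ t ∈ Icc 1 T, (M * ρ t).trace.re := by
  rw [timeAvg, mul_smul_comm, trace_smul, Complex.smul_re, smul_eq_mul, Matrix.mul_sum, trace_sum,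
    Complex.re_sum]

theorem re_trace_timeAvg_mul [Fintype n] (T : ℕ) (ρ : ℕ → Matrix n n ℂ) (M : Matrix n n ℂ) :
    (timeAvg T ρ * M).trace.re = (T : ℝ)⁻¹ * ∑ t ∈ Icc 1 T, (ρ t * M).trace.re := by
  simp only [trace_mul_comm _ M, re_trace_mul_timeAvg]

theorem kronecker_timeAvg (T : ℕ) (A : Matrix m m ℂ) (ρ : ℕ → Matrix n n ℂ) :
    A ⊗ₖ timeAvg T ρ = timeAvg T fun t => A ⊗ₖ ρ t := by
  ext x y
  simp [timeAvg, Matrix.sum_apply, mul_sum]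
  exact Finset.sum_congr rfl fun _ _ => by ring

theorem timeAvg_congr {T : ℕ} {ρ σ : ℕ → Matrix n n ℂ} (h : ∀ t, 1 ≤ t → ρ t = σ t) :
    timeAvg T ρ = timeAvg T σ := by
  rw [timeAvg, timeAvg, sum_congr rfl fun t ht => h t (mem_Icc.1 ht).1]

theorem timeAvg_mem_convexHull {T : ℕ} (hT : 1 ≤ T) {S : Set (Matrix n n ℂ)}
    {ρ : ℕ → Matrix n n ℂ} (hρ : ∀ t, 1 ≤ t → ρ t ∈ S) : timeAvg T ρ ∈ convexHull ℝ S := by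
  have hT' : (T : ℝ) ≠ 0 := by positivity
  rw [timeAvg, smul_sum]
  refine (convex_convexHull ℝ S).sum_mem (fun _ _ => by positivity) ?_
    fun t ht => subset_convexHull ℝ S (hρ t (mem_Icc.1 ht).1)
  simp [hT']

theorem convex_isDensity [Fintype n] : Convex ℝ {ρ : Matrix n n ℂ | IsDensity ρ} := by
  intro ρ hρ σ hσ a b ha hb hab
  refine ⟨(hρ.1.smul ha).add (hσ.1.smul hb), ?_⟩
  rw [trace_add, trace_smul, trace_smul, hρ.2, hσ.2, ← add_smul, hab, one_smul]

theorem IsDensity.timeAvg [Fintype n] {T : ℕ} (hT : 1 ≤ T) {ρ : ℕ → Matrix n n ℂ}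
    (hρ : ∀ t, 1 ≤ t → IsDensity (ρ t)) : IsDensity (timeAvg T ρ) :=
  convexHull_min subset_rfl convex_isDensity (timeAvg_mem_convexHull hT hρ)

end TimeAvg

/-! ### Hermiticity of the Choi maps -/

section Choi

variable {A B : Type*} [Fintype A] [DecidableEq A] [Fintype B]

theorem choiMap_isHermitian {R : Matrix (A × B) (A × B) ℂ} (hR : R.IsHermitian)
    {Y : Matrix B B ℂ} (hY : Y.IsHermitian) : (choiMap R Y).IsHermitian := by
  ext a a'
  rw [conjTranspose_apply, choiMap_apply, choiMap_apply, star_sum, sum_comm]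
  simp only [star_sum, star_mul', hR.apply, hY.apply]

theorem choiAdjoint_isHermitian {A B : Type*} [Fintype A] [Fintype B] [DecidableEq B] {R : Matrix (A × B) (A × B) ℂ}
    (hR : R.IsHermitian) {X : Matrix A A ℂ} (hX : X.IsHermitian) :
    (choiAdjoint R X).IsHermitian := by
  ext b b'
  rw [conjTranspose_apply, choiAdjoint_apply, choiAdjoint_apply, star_sum, sum_comm]
  simp only [star_sum, star_mul', hR.apply, hX.apply]

end Choi

/-! ### Product states and replacement channels -/

section Tensor

variable {ι : Type*} [Fintype ι] {d : ι → Type*}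

theorem conjTranspose_tensorProd (ρ : ∀ i, Matrix (d i) (d i) ℂ) :
    (tensorProd ρ)ᴴ = tensorProd fun i => (ρ i)ᴴ := by
  ext a b
  simp [tensorProd]

theorem IsHermitian.tensorProd {ρ : ∀ i, Matrix (d i) (d i) ℂ} (h : ∀ i, (ρ i).IsHermitian) :
    (tensorProd ρ).IsHermitian :=
  (conjTranspose_tensorProd ρ).trans (congrArg _ (funext h))

variable [DecidableEq ι]

theorem tensorProd_mul [∀ i, Fintype (d i)] (ρ σ : ∀ i, Matrix (d i) (d i) ℂ) :
    tensorProd (fun i => ρ i * σ i) = tensorProd ρ * tensorProd σ := by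
  ext a b
  simp only [tensorProd, of_apply, mul_apply, prod_univ_sum, Fintype.piFinset_univ,
    prod_mul_distrib]

theorem trace_tensorProd [∀ i, Fintype (d i)] (ρ : ∀ i, Matrix (d i) (d i) ℂ) :
    (tensorProd ρ).trace = ∏ i, (ρ i).trace := by
  simp only [trace, diag_apply, tensorProd, of_apply, prod_univ_sum, Fintype.piFinset_univ]

-- Writing each factor as B†B exhibits the tensor product in the same form.
open scoped MatrixOrder Matrix.Norms.L2Operator in
theorem PosSemidef.tensorProd [∀ i, Fintype (d i)] [∀ i, DecidableEq (d i)]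
    {ρ : ∀ i, Matrix (d i) (d i) ℂ}
    (h : ∀ i, (ρ i).PosSemidef) : (tensorProd ρ).PosSemidef := by
  choose B hB using fun i => CStarAlgebra.nonneg_iff_eq_star_mul_self.1 (h i).nonneg
  have : QGame.tensorProd ρ = (QGame.tensorProd B)ᴴ * QGame.tensorProd B := by
    rw [conjTranspose_tensorProd, ← tensorProd_mul]
    exact congrArg _ (funext hB)
  rw [this]
  exact posSemidef_conjTranspose_mul_self _

theorem IsDensity.tensorProd [∀ i, Fintype (d i)] [∀ i, DecidableEq (d i)]
    {ρ : ∀ i, Matrix (d i) (d i) ℂ} (h : ∀ i, IsDensity (ρ i)) : IsDensity (tensorProd ρ) :=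
  ⟨PosSemidef.tensorProd fun i => (h i).1, by simp [trace_tensorProd, (h _).2]⟩

omit [Fintype ι] in
theorem IsDensity.update [∀ i, Fintype (d i)] {ρ : ∀ i, Matrix (d i) (d i) ℂ}
    (h : ∀ i, IsDensity (ρ i)) {i : ι} {σ : Matrix (d i) (d i) ℂ} (hσ : IsDensity σ) (j : ι) :
    IsDensity (Function.update ρ i σ j) := by
  rcases eq_or_ne j i with rfl | hj
  · simpa using hσ
  · simpa [hj] using h j

theorem tensorProd_apply_split (ρ : ∀ i, Matrix (d i) (d i) ℂ) (i : ι) (a b : ∀ i, d i) :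
    tensorProd ρ a b = ρ i (a i) (b i) * ∏ j : {j // j ≠ i}, ρ j (a j) (b j) := by
  rw [tensorProd, of_apply, Fintype.prod_eq_mul_prod_subtype_ne _ i]

theorem tensorProd_update_apply (ρ : ∀ i, Matrix (d i) (d i) ℂ) (i : ι)
    (σ : Matrix (d i) (d i) ℂ) (a b : ∀ i, d i) :
    tensorProd (Function.update ρ i σ) a b =
      σ (a i) (b i) * ∏ j : {j // j ≠ i}, ρ j (a j) (b j) := by
  rw [tensorProd_apply_split _ i, Function.update_self]
  congr 1
  exact prod_congr rfl fun j _ => by rw [Function.update_of_ne j.2]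

theorem onFactor_replacement_tensorProd [∀ i, Fintype (d i)] (ρ : ∀ i, Matrix (d i) (d i) ℂ)
    {i : ι} (hρ : (ρ i).trace = 1) (σ : Matrix (d i) (d i) ℂ) :
    onFactor i (replacement σ) (tensorProd ρ) = tensorProd (Function.update ρ i σ) := by
  ext a b
  rw [tensorProd_update_apply, onFactor, of_apply, replacement, Matrix.smul_apply, smul_eq_mul, mul_comm]
  congr 1
  have h : ∀ x, tensorProd ρ (Function.update a i x) (Function.update b i x) =
      ρ i x x * ∏ j : {j // j ≠ i}, ρ j (a j) (b j) := by
    intro x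
    rw [tensorProd_apply_split _ i, Function.update_self, Function.update_self]
    congr 1
    exact prod_congr rfl fun j _ => by rw [Function.update_of_ne j.2, Function.update_of_ne j.2]
  simp only [trace, diag_apply, of_apply, h, ← sum_mul]
  rw [show ∑ x, ρ i x x = 1 from hρ, one_mul]

omit [Fintype ι] in
theorem onFactor_replacement_timeAvg [∀ i, Fintype (d i)] (T : ℕ) (i : ι)
    (σ : Matrix (d i) (d i) ℂ) (ρ : ℕ → Matrix (∀ i, d i) (∀ i, d i) ℂ) :
    onFactor i (replacement σ) (timeAvg T ρ) =
      timeAvg T fun t => onFactor i (replacement σ) (ρ t) := by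
  ext a b
  simp only [onFactor, replacement, timeAvg, of_apply, Matrix.smul_apply, Matrix.sum_apply, trace, diag_apply,
    smul_eq_mul, ← smul_sum, smul_mul_assoc]
  rw [sum_comm, sum_mul]

end Tensor

/-! ### Gains and regret in a quantum game -/

namespace QuantumGame

variable {ι : Type*} [Fintype ι] [DecidableEq ι] {d : ι → Type*} [∀ i, Fintype (d i)]
  [∀ i, DecidableEq (d i)] (Γ : QuantumGame ι d)

theorem gain_isHermitian (i : ι) {ρ : ∀ j, Matrix (d j) (d j) ℂ}
    (h : ∀ j, IsDensity (ρ j)) : (Γ.gain i ρ).IsHermitian :=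
  choiMap_isHermitian ((Γ.herm i).submatrix _)
    (IsHermitian.tensorProd fun j : {j // j ≠ i} => (h j).1.isHermitian).transpose

/-- The transpose in the gain cancels the one in the Choi map; the rest is a reindexing that splits
off coordinate i. -/
theorem trace_mul_gain (i : ι) (ρ : ∀ j, Matrix (d j) (d j) ℂ) (σ : Matrix (d i) (d i) ℂ) :
    (σ * Γ.gain i ρ).trace = (tensorProd (Function.update ρ i σ) * Γ.R i).trace := by
  set e := Equiv.piSplitAt i d
  have hfst : ∀ p, e.symm p i = p.1 := fun p => congrArg Prod.fst (e.apply_symm_apply p)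
  have hsnd : ∀ p (j : {j // j ≠ i}), e.symm p j = p.2 j := fun p j =>
    congrFun (congrArg Prod.snd (e.apply_symm_apply p)) j
  have hR : (tensorProd (Function.update ρ i σ) * Γ.R i).trace =
      ∑ p, ∑ q, tensorProd (Function.update ρ i σ) (e.symm p) (e.symm q) *
        Γ.R i (e.symm q) (e.symm p) := by
    simp only [trace, diag_apply, mul_apply]
    rw [← e.symm.sum_comp]
    exact sum_congr rfl fun p _ => (e.symm.sum_comp _).symm
  rw [hR]
  simp only [tensorProd_update_apply, hfst, hsnd]
  simp only [trace, diag_apply, mul_apply, Fintype.sum_prod_type, gain, theta, choiMap_apply,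
    transpose_apply, reindex_apply, submatrix_apply, tensorProd, of_apply, mul_sum]
  refine sum_congr rfl fun a _ => ?_
  rw [sum_comm (γ := ∀ j : {j // j ≠ i}, d j)]
  refine sum_congr rfl fun a' _ => ?_
  rw [sum_comm]
  exact sum_congr rfl fun b _ => sum_congr rfl fun b' _ => by
    rw [mul_assoc, mul_comm (∏ _, _)]

theorem re_trace_mul_gain (i : ι) (ρ : ∀ j, Matrix (d j) (d j) ℂ) (σ : Matrix (d i) (d i) ℂ) :
    (σ * Γ.gain i ρ).trace.re = Γ.utility i (tensorProd (Function.update ρ i σ)) := by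
  rw [trace_mul_gain, utility]

omit [∀ i, DecidableEq (d i)] in
theorem utility_timeAvg (i : ι) (T : ℕ) (ρ : ℕ → Matrix (∀ i, d i) (∀ i, d i) ℂ) :
    Γ.utility i (timeAvg T ρ) = (T : ℝ)⁻¹ * ∑ t ∈ Icc 1 T, Γ.utility i (ρ t) :=
  re_trace_timeAvg_mul T ρ _

variable {Γ} [∀ i, Nonempty (d i)] {η : ℝ} {ρ : ∀ i, ℕ → Matrix (d i) (d i) ℂ}

theorem AllMMWU.isDensity (h : Γ.AllMMWU η ρ) (t : ℕ) (ht : 1 ≤ t) (i : ι) :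
    IsDensity (ρ i t) := by
  induction t using Nat.strong_induction_on generalizing i with
  | _ t ih =>
    obtain ⟨W, hW⟩ := h i
    exact hW.isDensity_play ht fun τ h1 h2 => Γ.gain_isHermitian i fun j => ih τ h2 h1 j

theorem AllMMWU.regret_le (h : Γ.AllMMWU η ρ) (hb : Γ.UtilitiesBounded) (h0 : 0 < η) (h1 : η ≤ 1)
    (T : ℕ) (i : ι) {σ : Matrix (d i) (d i) ℂ} (hσ : IsDensity σ) :
    η * ∑ t ∈ Icc 1 T, Γ.utility i (tensorProd (Function.update (fun j => ρ j t) i σ)) ≤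
      Real.log (maxDim d) + η * ∑ t ∈ Icc 1 T, Γ.utility i (tensorProd fun j => ρ j t) +
        η ^ 2 * T := by
  obtain ⟨W, hW⟩ := h i
  have key := hW.regret_le h0 h1 (fun t ht => Γ.gain_isHermitian i fun j => h.isDensity t ht j)
    (fun t ht τ hτ => by
      rw [re_trace_mul_gain]
      exact hb i _ (IsDensity.update (fun j => h.isDensity t ht j) hτ)) T hσ
  simp only [re_trace_mul_gain] at key
  have hupd : ∀ t, Function.update (fun j => ρ j t) i (ρ i t) = fun j => ρ j t := fun t =>
    Function.update_eq_self i _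
  simp only [hupd] at key
  have hlog : Real.log (Fintype.card (d i)) ≤ Real.log (maxDim d) :=
    Real.log_le_log (by exact_mod_cast Fintype.card_pos)
      (by exact_mod_cast le_sup (f := fun i => Fintype.card (d i)) (mem_univ i))
  linarith

end QuantumGame

/-! ### Coarse correlated equilibria in general games -/

namespace QuantumGame

variable {ι : Type*} [Fintype ι] [DecidableEq ι] {d : ι → Type*} [∀ i, Fintype (d i)]
  [∀ i, DecidableEq (d i)] [∀ i, Nonempty (d i)] {Γ : QuantumGame ι d}
  {ρ : ∀ i, ℕ → Matrix (d i) (d i) ℂ} {T : ℕ}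

theorem AllMMWU.isSeparable_timeAvg {η : ℝ} (h : Γ.AllMMWU η ρ) (hT : 1 ≤ T) :
    IsSeparable (timeAvg T fun t => tensorProd fun i => ρ i t) :=
  timeAvg_mem_convexHull hT fun t ht => ⟨fun i => ρ i t, h.isDensity t ht, rfl⟩

/-- The averaged regret is at most twice the stepsize once `T ≥ ln n / η²`. -/
theorem AllMMWU.avg_regret_le {η : ℝ} (h : Γ.AllMMWU η ρ) (hb : Γ.UtilitiesBounded) (h0 : 0 < η)
    (h1 : η ≤ 1) (hT : 1 ≤ T) (hlog : Real.log (maxDim d) ≤ η ^ 2 * T) (i : ι)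
    {σ : Matrix (d i) (d i) ℂ} (hσ : IsDensity σ) :
    (T : ℝ)⁻¹ * ∑ t ∈ Icc 1 T, Γ.utility i (tensorProd (Function.update (fun j => ρ j t) i σ)) ≤
      (T : ℝ)⁻¹ * ∑ t ∈ Icc 1 T, Γ.utility i (tensorProd fun j => ρ j t) + 2 * η := by
  have key := h.regret_le hb h0 h1 T i hσ
  exact avg_le_avg_add h0 hT (by linarith)

theorem AllMMWU.isQCCE_timeAvg {ε : ℝ} (h : Γ.AllMMWU (ε / 2) ρ) (hb : Γ.UtilitiesBounded)
    (h0 : 0 < ε) (h2 : ε ≤ 2) (hT : 1 ≤ T) (hlog : 4 * Real.log (maxDim d) / ε ^ 2 ≤ T) :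
    Γ.IsQCCE ε (timeAvg T fun t => tensorProd fun i => ρ i t) := by
  refine ⟨IsDensity.timeAvg hT fun t ht => IsDensity.tensorProd (h.isDensity t ht),
    fun i σ hσ => ?_⟩
  have key := h.avg_regret_le hb (by linarith) (by linarith) hT
    (by rw [div_le_iff₀ (by positivity)] at hlog; linarith) i hσ
  have e : onFactor i (replacement σ) (timeAvg T fun t => tensorProd fun i => ρ i t) =
      timeAvg T fun t => tensorProd (Function.update (fun j => ρ j t) i σ) := by
    rw [onFactor_replacement_timeAvg]
    exact timeAvg_congr fun t ht =>
      onFactor_replacement_tensorProd (fun j => ρ j t) (h.isDensity t ht i).2 σ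
  rw [e, utility_timeAvg, utility_timeAvg]
  linarith

end QuantumGame

/-! ### Two-player zero-sum games -/

namespace ZeroSumGame

variable {A B : Type*} [Fintype A] [DecidableEq A] [Fintype B] [DecidableEq B]
  (Γ : ZeroSumGame A B)

omit [DecidableEq B] in
theorem re_trace_mul_choiMap {ρ : Matrix A A ℂ} (hρ : ρ.IsHermitian) (σ : Matrix B B ℂ) :
    (ρ * choiMap Γ.R σ).trace.re = Γ.payoff ρ σ := by
  rw [payoff, hsInner, hρ.eq]

theorem re_trace_mul_neg_choiAdjoint {ρ : Matrix A A ℂ} (hρ : ρ.IsHermitian) (σ : Matrix B B ℂ) :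
    (σ * -choiAdjoint Γ.R ρ).trace.re = -Γ.payoff ρ σ := by
  rw [payoff, hsInner_choiMap, hsInner, (choiAdjoint_isHermitian Γ.herm hρ).eq, trace_mul_comm,
    Matrix.neg_mul, trace_neg, Complex.neg_re]

omit [DecidableEq B] in
theorem payoff_timeAvg_left (T : ℕ) (ρ : ℕ → Matrix A A ℂ) (σ : Matrix B B ℂ) :
    Γ.payoff (timeAvg T ρ) σ = (T : ℝ)⁻¹ * ∑ t ∈ Icc 1 T, Γ.payoff (ρ t) σ := by
  simp only [payoff, hsInner]
  rw [conjTranspose_timeAvg, re_trace_timeAvg_mul]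

theorem payoff_timeAvg_right (T : ℕ) (ρ : Matrix A A ℂ) (σ : ℕ → Matrix B B ℂ) :
    Γ.payoff ρ (timeAvg T σ) = (T : ℝ)⁻¹ * ∑ t ∈ Icc 1 T, Γ.payoff ρ (σ t) := by
  simp only [payoff, hsInner_choiMap]
  simp only [hsInner, re_trace_mul_timeAvg]

variable {Γ} [Nonempty A] [Nonempty B] {ρ : ℕ → Matrix A A ℂ} {σ : ℕ → Matrix B B ℂ}

theorem AllMMWU.isDensity {η : ℝ} (h : Γ.AllMMWU η ρ σ) (t : ℕ) (ht : 1 ≤ t) :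
    IsDensity (ρ t) ∧ IsDensity (σ t) := by
  induction t using Nat.strong_induction_on with
  | _ t ih =>
    obtain ⟨⟨W, hW⟩, ⟨V, hV⟩⟩ := h
    exact ⟨hW.isDensity_play ht fun τ h1 h2 =>
        choiMap_isHermitian Γ.herm (ih τ h2 h1).2.1.isHermitian,
      hV.isDensity_play ht fun τ h1 h2 =>
        (choiAdjoint_isHermitian Γ.herm (ih τ h2 h1).1.1.isHermitian).neg⟩

theorem AllMMWU.isQNE_timeAvg {ε : ℝ} {T : ℕ} (h : Γ.AllMMWU (ε / 4) ρ σ)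
    (hb : Γ.UtilitiesBounded) (h0 : 0 < ε) (h4 : ε ≤ 4) (hT : 1 ≤ T)
    (hlog : 16 * Real.log (max (Fintype.card A) (Fintype.card B) : ℕ) / ε ^ 2 ≤ T) :
    Γ.IsQNE ε (timeAvg T ρ) (timeAvg T σ) := by
  have hρ : ∀ t, 1 ≤ t → IsDensity (ρ t) := fun t ht => (h.isDensity t ht).1
  have hσ : ∀ t, 1 ≤ t → IsDensity (σ t) := fun t ht => (h.isDensity t ht).2
  have hη : 0 < ε / 4 := by linarith
  rw [div_le_iff₀ (by positivity)] at hlog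
  set N := max (Fintype.card A) (Fintype.card B)
  have hA : Real.log (Fintype.card A) ≤ Real.log N :=
    Real.log_le_log (by exact_mod_cast Fintype.card_pos) (by exact_mod_cast le_max_left _ _)
  have hB : Real.log (Fintype.card B) ≤ Real.log N :=
    Real.log_le_log (by exact_mod_cast Fintype.card_pos) (by exact_mod_cast le_max_right _ _)
  obtain ⟨⟨W, hW⟩, ⟨V, hV⟩⟩ := h
  have alice : ∀ ρ', IsDensity ρ' → Γ.payoff ρ' (timeAvg T σ) ≤
      (T : ℝ)⁻¹ * ∑ t ∈ Icc 1 T, Γ.payoff (ρ t) (σ t) + 2 * (ε / 4) := by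
    intro ρ' hρ'
    have key := hW.regret_le hη (by linarith)
      (fun t ht => choiMap_isHermitian Γ.herm (hσ t ht).1.isHermitian)
      (fun t ht τ hτ => by
        rw [re_trace_mul_choiMap Γ hτ.1.isHermitian]
        exact hb _ _ hτ (hσ t ht)) T hρ'
    rw [sum_congr rfl fun t _ => re_trace_mul_choiMap Γ hρ'.1.isHermitian (σ t),
      sum_congr rfl fun t ht =>
        re_trace_mul_choiMap Γ (hρ t (mem_Icc.1 ht).1).1.isHermitian (σ t)] at key
    rw [payoff_timeAvg_right]
    exact avg_le_avg_add hη hT (by linarith)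
  have bob : ∀ σ', IsDensity σ' → -Γ.payoff (timeAvg T ρ) σ' ≤
      -((T : ℝ)⁻¹ * ∑ t ∈ Icc 1 T, Γ.payoff (ρ t) (σ t)) + 2 * (ε / 4) := by
    intro σ' hσ'
    have key := hV.regret_le hη (by linarith)
      (fun t ht => (choiAdjoint_isHermitian Γ.herm (hρ t ht).1.isHermitian).neg)
      (fun t ht τ hτ => by
        rw [re_trace_mul_neg_choiAdjoint Γ (hρ t ht).1.isHermitian]
        have := hb _ _ (hρ t ht) hτ
        exact ⟨by linarith [this.2], by linarith [this.1]⟩) T hσ'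
    rw [sum_congr rfl fun t ht =>
        re_trace_mul_neg_choiAdjoint Γ (hρ t (mem_Icc.1 ht).1).1.isHermitian σ',
      sum_congr rfl fun t ht =>
        re_trace_mul_neg_choiAdjoint Γ (hρ t (mem_Icc.1 ht).1).1.isHermitian (σ t)] at key
    rw [payoff_timeAvg_left, ← mul_neg, ← mul_neg, ← sum_neg_distrib, ← sum_neg_distrib]
    exact avg_le_avg_add hη hT (by linarith)
  have dρ := IsDensity.timeAvg hT hρ
  have dσ := IsDensity.timeAvg hT hσ
  -- One player's bound at the deviation is added to the other's at its own average. The common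
  -- average payoff cancels, leaving ε/2 + ε/2.
  refine ⟨dρ, dσ, fun ρ' hρ' => ?_, fun σ' hσ' => ?_⟩
  · linarith [alice ρ' hρ', bob _ dσ]
  · linarith [alice _ dρ, bob σ' hσ']

end ZeroSumGame

/-! ### Polymatrix zero-sum games -/

namespace PolymatrixGame

variable {ι : Type*} [Fintype ι] [DecidableEq ι] {d : ι → Type*} [∀ i, Fintype (d i)]
  [∀ i, DecidableEq (d i)]

/-- Once the constraints on coordinates i and j are absorbed into the factors `h i` and `h j`, the
sum factorises, and every other factor is a trace equal to 1. -/
theorem pairMarginal_tensorProd {i j : ι} (hij : i ≠ j) {ρ : ∀ l, Matrix (d l) (d l) ℂ}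
    (hρ : ∀ l, (ρ l).trace = 1) : pairMarginal i j (tensorProd ρ) = ρ i ⊗ₖ ρ j := by
  ext ⟨x1, x2⟩ ⟨y1, y2⟩
  let h : ∀ l, d l → ℂ := Function.update (Function.update (fun l c => ρ l c c) i
    fun c => if c = x1 then ρ i c y1 else 0) j fun c => if c = x2 then ρ j c y2 else 0
  have hi : ∀ c, h i c = if c = x1 then ρ i c y1 else 0 := fun c => by
    simp only [h]
    rw [Function.update_of_ne hij, Function.update_self]
  have hj : ∀ c, h j c = if c = x2 then ρ j c y2 else 0 := fun c => by
    simp only [h]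
    rw [Function.update_self]
  have hl : ∀ l, l ≠ i → l ≠ j → ∀ c, h l c = ρ l c c := fun l h1 h2 c => by
    simp only [h]
    rw [Function.update_of_ne h2, Function.update_of_ne h1]
  have key : ∀ a : ∀ l, d l, (if a i = x1 ∧ a j = x2 then
      tensorProd ρ a (Function.update (Function.update a i y1) j y2) else 0) =
        ∏ l, h l (a l) := by
    intro a
    by_cases ha : a i = x1 ∧ a j = x2
    · rw [if_pos ha]
      refine prod_congr rfl fun l _ => ?_
      by_cases h2 : l = j
      · subst h2
        rw [hj, Function.update_self, if_pos ha.2]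
      by_cases h1 : l = i
      · subst h1
        rw [hi, Function.update_of_ne h2, Function.update_self, if_pos ha.1]
      rw [hl l h1 h2, Function.update_of_ne h2, Function.update_of_ne h1]
    · rw [if_neg ha]
      symm
      by_cases h1 : a i = x1
      · refine prod_eq_zero (mem_univ j) ?_
        rw [hj, if_neg fun h2 => ha ⟨h1, h2⟩]
      · refine prod_eq_zero (mem_univ i) ?_
        rw [hi, if_neg h1]
  rw [pairMarginal, of_apply, sum_congr rfl fun a _ => key a, ← Fintype.piFinset_univ,
    ← prod_univ_sum, Fintype.prod_eq_mul i j hij]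
  · simp [hi, hj]
  · rintro l ⟨h1, h2⟩
    simp only [hl l h1 h2]
    exact hρ l

open Classical in
theorem utility_tensorProd (P : PolymatrixGame ι d) (i : ι) {ρ : ∀ l, Matrix (d l) (d l) ℂ}
    (hρ : ∀ l, IsDensity (ρ l)) : P.utility i (tensorProd ρ) =
      ∑ j with P.graph.Adj i j, ((ρ i ⊗ₖ ρ j) * P.R i j).trace.re :=
  sum_congr rfl fun j hj => by
    rw [pairMarginal_tensorProd (mem_filter.1 hj).2.ne fun l => (hρ l).2]

/-- Each summand involves player i and one opponent only, so with σ fixed it is linear in that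
opponent's state. The product of averages thus gives the same utility as the average of products,
which fails for general tensors. -/
theorem utility_update_timeAvg (P : PolymatrixGame ι d) {T : ℕ} (hT : 1 ≤ T)
    {ρ : ∀ i, ℕ → Matrix (d i) (d i) ℂ} (hρ : ∀ t, 1 ≤ t → ∀ i, IsDensity (ρ i t)) (i : ι)
    {σ : Matrix (d i) (d i) ℂ} (hσ : IsDensity σ) :
    P.utility i (tensorProd (Function.update (fun j => timeAvg T (ρ j)) i σ)) =
      (T : ℝ)⁻¹ * ∑ t ∈ Icc 1 T,
        P.utility i (tensorProd (Function.update (fun j => ρ j t) i σ)) := by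
  classical
  rw [utility_tensorProd P i (IsDensity.update
      (fun j => IsDensity.timeAvg hT fun t ht => hρ t ht j) hσ),
    sum_congr rfl fun t ht => utility_tensorProd P i
      (IsDensity.update (fun j => hρ t (mem_Icc.1 ht).1 j) hσ), sum_comm, mul_sum]
  refine sum_congr rfl fun j hj => ?_
  have hne : j ≠ i := (mem_filter.1 hj).2.ne'
  simp only [Function.update_self, Function.update_of_ne hne]
  rw [kronecker_timeAvg, re_trace_timeAvg_mul]

theorem isQNE_timeAvg [∀ i, Nonempty (d i)] {P : PolymatrixGame ι d} (hz : P.IsZeroSum)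
    (hb : P.toGame.UtilitiesBounded) {ε : ℝ} {T : ℕ} {ρ : ∀ i, ℕ → Matrix (d i) (d i) ℂ}
    (h0 : 0 < ε) (hε : ε ≤ 2 * Fintype.card ι)
    (h : P.toGame.AllMMWU (ε / (2 * Fintype.card ι)) ρ) (hT : 1 ≤ T)
    (hlog : 4 * (Fintype.card ι : ℝ) ^ 2 * Real.log (maxDim d) / ε ^ 2 ≤ T) :
    P.toGame.IsQNE ε fun i => timeAvg T (ρ i) := by
  set k : ℝ := (Fintype.card ι : ℝ) with hk
  have hkpos : 0 < k := by linarith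
  have hd := h.isDensity
  have hdavg : ∀ i, IsDensity (timeAvg T (ρ i)) := fun i =>
    IsDensity.timeAvg hT fun t ht => hd t ht i
  set ρavg := fun i => timeAvg T (ρ i)
  have regret : ∀ (i : ι) {σ : Matrix (d i) (d i) ℂ}, IsDensity σ →
      P.utility i (tensorProd (Function.update ρavg i σ)) ≤
        (T : ℝ)⁻¹ * ∑ t ∈ Icc 1 T, P.utility i (tensorProd fun j => ρ j t) + ε / k := by
    intro i σ hσ
    have key := h.avg_regret_le hb (by positivity) ((div_le_one (by positivity)).2 hε) hT
      (by
        rw [div_le_iff₀ (by positivity)] at hlog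
        rw [div_pow, div_mul_eq_mul_div, le_div_iff₀ (by positivity)]
        linarith) i hσ
    simp only [toGame_utility] at key
    rw [utility_update_timeAvg P hT hd i hσ]
    refine key.trans_eq ?_
    field_simp
  refine ⟨hdavg, fun i σ hσ => ?_⟩
  rw [toGame_utility, toGame_utility]
  have hself : ∀ j, Function.update ρavg j (ρavg j) = ρavg := fun j => Function.update_eq_self j _
  -- The regret bound is tested against the player's own average.
  have hoff : ∀ j, P.utility j (tensorProd ρavg) ≤
      (T : ℝ)⁻¹ * ∑ t ∈ Icc 1 T, P.utility j (tensorProd fun l => ρ l t) + ε / k := fun j => by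
    have hj := regret j (hdavg j)
    rwa [show timeAvg T (ρ j) = ρavg j from rfl, hself] at hj
  have hsum : ∑ j, (T : ℝ)⁻¹ * ∑ t ∈ Icc 1 T, P.utility j (tensorProd fun l => ρ l t) = 0 := by
    rw [← mul_sum, sum_comm, sum_eq_zero, mul_zero]
    exact fun t ht => hz _ (IsDensity.tensorProd (hd t (mem_Icc.1 ht).1))
  have hzavg := hz _ (IsDensity.tensorProd hdavg)
  have hconst : ∑ _j : ι, ε / k = ε := by
    rw [sum_const, card_univ, nsmul_eq_mul, ← hk]
    field_simp
  -- By the two zero sums, upper bounds for all j ≠ i give a lower bound for player i with loss (k -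
  -- 1)ε/k; player i's own regret adds the remaining ε/k.
  rw [← add_sum_erase _ _ (mem_univ i)] at hsum hzavg hconst
  have hle := sum_le_sum fun j (_ : j ∈ univ.erase i) => hoff j
  rw [sum_add_distrib] at hle
  linarith [regret i hσ]

end PolymatrixGame

end

end QGame

theorem mainTheorem8 :
    -- general quantum games
    (∀ {ι : Type*} [Fintype ι] [DecidableEq ι] {d : ι → Type*} [∀ i, Fintype (d i)]
        [∀ i, DecidableEq (d i)] [∀ i, Nonempty (d i)] (Γ : QGame.QuantumGame ι d)
        (ε : ℝ) (ρ : ∀ i, ℕ → Matrix (d i) (d i) ℂ) (T : ℕ),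
        Γ.UtilitiesBounded → 0 < ε → ε ≤ 2 → Γ.AllMMWU (ε / 2) ρ →
        1 ≤ T → 4 * Real.log (QGame.maxDim d) / ε ^ 2 ≤ T →
        QGame.IsSeparable (QGame.timeAvg T fun t => QGame.tensorProd fun i => ρ i t) ∧
          Γ.IsQCCE ε (QGame.timeAvg T fun t => QGame.tensorProd fun i => ρ i t)) ∧
    -- two-player quantum zero-sum games
    (∀ {A B : Type*} [Fintype A] [DecidableEq A] [Nonempty A] [Fintype B] [DecidableEq B]
        [Nonempty B] (Γ : QGame.ZeroSumGame A B) (ε : ℝ)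
        (ρ : ℕ → Matrix A A ℂ) (σ : ℕ → Matrix B B ℂ) (T : ℕ),
        Γ.UtilitiesBounded → 0 < ε → ε ≤ 4 → Γ.AllMMWU (ε / 4) ρ σ →
        1 ≤ T → 16 * Real.log (max (Fintype.card A) (Fintype.card B) : ℕ) / ε ^ 2 ≤ T →
        Γ.IsQNE ε (QGame.timeAvg T ρ) (QGame.timeAvg T σ)) ∧
    -- polymatrix quantum zero-sum games
    (∀ {ι : Type*} [Fintype ι] [DecidableEq ι] {d : ι → Type*} [∀ i, Fintype (d i)]
        [∀ i, DecidableEq (d i)] [∀ i, Nonempty (d i)] (P : QGame.PolymatrixGame ι d)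
        (ε : ℝ) (ρ : ∀ i, ℕ → Matrix (d i) (d i) ℂ) (T : ℕ),
        P.IsZeroSum → P.toGame.UtilitiesBounded → 0 < ε → ε ≤ 2 * Fintype.card ι →
        P.toGame.AllMMWU (ε / (2 * Fintype.card ι)) ρ →
        1 ≤ T → 4 * (Fintype.card ι : ℝ) ^ 2 * Real.log (QGame.maxDim d) / ε ^ 2 ≤ T →
        P.toGame.IsQNE ε fun i => QGame.timeAvg T (ρ i)) := by
  refine ⟨?_, ?_, ?_⟩
  · intro ι _ _ d _ _ _ Γ ε ρ T hb h0 h2 h hT hlog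
    exact ⟨h.isSeparable_timeAvg hT, h.isQCCE_timeAvg hb h0 h2 hT hlog⟩
  · intro A B _ _ _ _ _ _ Γ ε ρ σ T hb h0 h4 h hT hlog
    exact h.isQNE_timeAvg hb h0 h4 hT hlog
  · intro ι _ _ d _ _ _ P ε ρ T hz hb h0 hε h hT hlog
    exact QGame.PolymatrixGame.isQNE_timeAvg hz hb h0 hε h hT hlog
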